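/- Let $q$ be a prime power and, for $n\ge 1$ coprime to $q$, let $|\Omega_n|$ (resp. $|\overline\Omega_n|$) be the number of self-reciprocal monic irreducible factors of $X^n-1$ over $\mathbb{F}_q$ (resp. over $\mathbb{F}_{q^2}$), where a monic polynomial $h$ of degree $k$ with $h(0)\neq 0$ is called self-reciprocal if $h(X)=h(0)^{-1}X^kh(X^{-1})$. Let $\mathrm{ord}_n(q)$ be the multiplicative order of $q$ modulo $n$ (so $\mathrm{ord}_1(q)=1$), let $\phi$ be Euler's function, and let $a\ge 0$ be the integer with $2^a\,\|\,(q+1)$, i.e. $2^a\mid q+1$ and $2^{a+1}\nmid q+1$; likewise $2\,\|\,r$ means $2\mid r$ and $4\nmid r$. Let $\ell$ be an odd prime coprime to $q$, let $s\geq 1$ and $m\ge 0$ be integers, and assume that $2^m\ell^s$ is coprime to $q$ (that is, $q$ is odd if $m\ge1$). If $\mathrm{ord}_\ell(q)$ is odd, then $|\Omega_{2^m\ell^s}|=|\Omega_{2^m}|$, where $$|\Omega_{2^m}|=\begin{cases}1,& m=0;\\ 2,& m=1,\text{ or } m\ge 2 \text{ and } 4\mid (q-1);\\ 2^{\min\{m,a\}-1}+1,&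 m\ge 2\text{ and } 4\nmid (q-1).\end{cases}$$ If $\mathrm{ord}_\ell(q)$ is even, then: (i) If $m=1$, or $m\ge2$ and $4\mid(q-1)$, then $$|\Omega_{2^m\ell^s}|=2|\Omega_{\ell^s}|=2\sum_{d=0}^s\frac{\phi(\ell^d)}{\mathrm{ord}_{\ell^d}(q)}.$$ (ii) If $m\ge2$ and $4\nmid(q-1)$, then $$|\Omega_{2^m\ell^s}|=2\sum_{d=0}^s\frac{\phi(\ell^d)}{\mathrm{ord}_{\ell^d}(q)}+\left(2^{\min\{m,a\}-1}-1\right)\left(2\sum_{d=0}^s\frac{\phi(\ell^d)}{\mathrm{ord}_{\ell^d}(q)}-|\overline\Omega_{\ell^s}|\right).$$ Here, if $2\,\|\,\mathrm{ord}_\ell(q)$, then $|\overline\Omega_{\ell^s}|=1$; otherwise $|\overline\Omega_{\ell^s}|=2\sum_{d=0}^s\frac{\phi(\ell^d)}{\mathrm{ord}_{\ell^d}(q)}-1$. -/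

import Mathlib

open Polynomial

/-- The reciprocal polynomial `h(X)^* = h(0)⁻¹ X^k h(X⁻¹)`, where `k = deg h`, of a polynomial over
a field. (It is only meant for polynomials with `h(0) ≠ 0`.) -/
noncomputable def reciprocalPoly {F : Type*} [Field F] (h : F[X]) : F[X] :=
  C (h.eval 0)⁻¹ * h.reverse

/-- A polynomial with nonzero constant term is self-reciprocal if it equals its reciprocal
polynomial. -/
def IsSelfReciprocal {F : Type*} [Field F] (h : F[X]) : Prop :=
  h.eval 0 ≠ 0 ∧ h = reciprocalPoly h

/-- The set of self-reciprocal monic irreducible factors of `X^n - 1` over the field `F`. -/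
def selfReciprocalFactors (F : Type*) [Field F] (n : ℕ) : Set F[X] :=
  {h | h.Monic ∧ Irreducible h ∧ h ∣ X ^ n - 1 ∧ IsSelfReciprocal h}

/-- The number of self-reciprocal monic irreducible factors of `X^n - 1` over `F`: this is `|Ω_n|`
for `F = 𝔽_q`, and it is `|Ω̄_n|` for `F = 𝔽_{q²}`. -/
noncomputable def cardOmega (F : Type*) [Field F] (n : ℕ) : ℕ :=
  (selfReciprocalFactors F n).ncard

/-- The multiplicative order of `q` modulo `n`. -/
noncomputable def ordMod (n q : ℕ) : ℕ := orderOf (q : ZMod n)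

/-- The rational number `∑_{d=0}^s φ(ℓ^d) / ord_{ℓ^d}(q)`. -/
noncomputable def cosetSum (q ℓ s : ℕ) : ℚ :=
  ∑ d ∈ Finset.range (s + 1), (Nat.totient (ℓ ^ d) : ℚ) / (ordMod (ℓ ^ d) q : ℚ)

/-!
The roots of `X ^ n - 1` of order `d` are the roots of the `d`-th cyclotomic polynomial, which over
`𝔽_q` has `φ(d) / ord_d(q)` monic irreducible factors. The roots of such a factor are the powers
`α ^ (q ^ k)` of one root `α`, and the factor is self-reciprocal iff `α⁻¹` is one of them, that is,
iff `-1` is a power of `q` modulo `d` (`isSelfReciprocal_iff_of_dvd_cyclotomic`). Hence the number of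
self-reciprocal factors of `X ^ n - 1` is the sum of `φ(d) / ord_d(q)` over those `d ∣ n` for which
`d ∣ q ^ k + 1` for some `k` (`cardOmega_eq_sum_divisors`).

It remains to decide, for `d = 2 ^ i * ℓ ^ j`, which `k` satisfy `d ∣ q ^ k + 1`.
* For `j ≥ 1`, `ℓ ^ j ∣ q ^ k + 1` holds iff `k` is an odd multiple of half the order of `q` modulo
  `ℓ ^ j` (`prime_pow_dvd_pow_add_one_iff`). This order is an odd multiple of `ord_ℓ(q)`. So some `k`
  exists iff `ord_ℓ(q)` is even, and some odd `k` exists iff `ord_ℓ(q) ≡ 2` modulo `4`.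
* For `i ≥ 2`, `2 ^ i ∣ q ^ k + 1` never holds if `q ≡ 1` modulo `4`, and holds iff `k` is odd and
  `i ≤ a` if `q ≡ 3` modulo `4` (`two_pow_dvd_pow_add_one_iff`).

Summing over `j` for fixed `i` (`weightRow`), the rows `i = 0` and `i = 1` agree, and the rows
`2 ≤ i ≤ a` double from one to the next when `q ≡ 3` modulo `4`; all others vanish. The count over
the quadratic extension is the same count for `q ^ 2`, since `ord_d(q ^ 2) = ord_d(q) / 2` when
`ord_d(q)` is even.
-/

/-! ### Self-reciprocal factors over a finite field -/

/-- A factor of the `d`-th cyclotomic polynomial has a primitive `d`-th root of unity as root. -/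
lemma isPrimitiveRoot_root_of_dvd_cyclotomic {F : Type*} [Field F] {P : F[X]}
    (hP : Irreducible P) {d : ℕ} (hd : (d : F) ≠ 0) (hPd : P ∣ cyclotomic d F) :
    haveI := Fact.mk hP
    IsPrimitiveRoot (AdjoinRoot.root P) d := by
  have := Fact.mk hP
  have : NeZero (d : F) := ⟨hd⟩
  have : NeZero (d : AdjoinRoot P) := by
    simpa using! NeZero.of_injective (a := (d : F)) (algebraMap F (AdjoinRoot P)).injective
  simpa [← isRoot_cyclotomic_iff] using! (AdjoinRoot.isRoot_root P).dvd
      (by simpa using! map_dvd (algebraMap F (AdjoinRoot P)) hPd)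

/-- A monic irreducible polynomial with root `α ≠ 0` is self-reciprocal iff `α⁻¹` is a root. -/
lemma isSelfReciprocal_iff_aeval_inv_root {F : Type*} [Field F] {P : F[X]}
    (hP : Irreducible P) (hmon : P.Monic) (h0 : P.eval 0 ≠ 0) :
    haveI := Fact.mk hP
    IsSelfReciprocal P ↔ aeval (AdjoinRoot.root P)⁻¹ P = 0 := by
  have := Fact.mk hP
  have hα : AdjoinRoot.root P ≠ 0 := by
    intro h
    have h1 := AdjoinRoot.eval₂_root P
    rw [h, eval₂_at_zero, map_eq_zero, coeff_zero_eq_eval_zero] at h1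
    exact h0 h1
  let : Invertible (AdjoinRoot.root P)⁻¹ := invertibleOfNonzero (inv_ne_zero hα)
  have hrev := eval₂_reverse_eq_zero_iff (algebraMap F (AdjoinRoot P)) (AdjoinRoot.root P)⁻¹ P
  rw [invOf_eq_inv, inv_inv, ← aeval_def, ← aeval_def, AdjoinRoot.aeval_eq,
    AdjoinRoot.mk_eq_zero] at hrev
  rw [← hrev, IsSelfReciprocal, and_iff_right h0, reciprocalPoly]
  have hu : IsUnit (C (P.eval 0)⁻¹) := isUnit_C.2 (isUnit_iff_ne_zero.2 (inv_ne_zero h0))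
  constructor
  · intro h
    exact (hu.dvd_mul_left).1 (Eq.dvd h)
  · intro h
    have hr0 : P.reverse ≠ 0 := by simpa using hP.ne_zero
    have htr : P.natTrailingDegree = 0 := by
      rw [natTrailingDegree_eq_zero]; right; rwa [coeff_zero_eq_eval_zero]
    refine eq_of_monic_of_associated hmon ?_ ?_
    · rw [Monic, leadingCoeff_mul, leadingCoeff_C, reverse_leadingCoeff, trailingCoeff, htr,
        coeff_zero_eq_eval_zero, inv_mul_cancel₀ h0]
    · exact (associated_of_dvd_of_natDegree_le h hr0 (reverse_natDegree_le P)).trans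
        (associated_unit_mul_right _ _ hu)

/-- The roots of an irreducible polynomial over `𝔽_q` are the iterated `q`-th powers of one of
them. -/
lemma aeval_eq_zero_iff_exists_pow {F : Type*} [Field F] [Fintype F] {P : F[X]}
    (hP : Irreducible P) (hmon : P.Monic) :
    haveI := Fact.mk hP
    ∀ β : AdjoinRoot P, aeval β P = 0 ↔ ∃ k, β = AdjoinRoot.root P ^ (Fintype.card F ^ k) := by
  have := Fact.mk hP
  intro β
  have := hmon.finite_adjoinRoot
  have : Finite (AdjoinRoot P) := Module.finite_of_finite F
  have hφ : ∀ k : ℕ, (FiniteField.frobeniusAlgEquivOfAlgebraic F (AdjoinRoot P) ^ k)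
      (AdjoinRoot.root P) = AdjoinRoot.root P ^ (Fintype.card F ^ k) := by
    intro k
    simp [AlgEquiv.coe_pow, FiniteField.coe_frobeniusAlgEquivOfAlgebraic, pow_iterate]
  have hroot : aeval (AdjoinRoot.root P) P = 0 := AdjoinRoot.eval₂_root P
  constructor
  · intro h
    have hmin : minpoly F (AdjoinRoot.root P) = P :=
      (minpoly.eq_of_irreducible_of_monic hP hroot hmon).symm
    obtain ⟨σ, hσ⟩ := minpoly.exists_algEquiv_of_root' (K := F) (x := β)
      (y := AdjoinRoot.root P) (Algebra.IsAlgebraic.isAlgebraic _) (by rwa [hmin])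
    obtain ⟨k, rfl⟩ :=
      (FiniteField.bijective_frobeniusAlgEquivOfAlgebraic_pow F (AdjoinRoot P)).2 σ
    exact ⟨k, by rw [← hσ, ← hφ]⟩
  · rintro ⟨k, rfl⟩
    rw [← hφ, aeval_algHom_apply, hroot, map_zero]

/-- A monic irreducible factor of the `d`-th cyclotomic polynomial over `𝔽_q` is self-reciprocal
iff `-1` is a power of `q` modulo `d`. -/
lemma isSelfReciprocal_iff_of_dvd_cyclotomic {F : Type*} [Field F] [Fintype F] {P : F[X]}
    (hP : Irreducible P) (hmon : P.Monic) {d : ℕ} (hd : (d : F) ≠ 0)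
    (hPd : P ∣ cyclotomic d F) :
    IsSelfReciprocal P ↔ ∃ k, d ∣ Fintype.card F ^ k + 1 := by
  have := Fact.mk hP
  have hd0 : d ≠ 0 := by rintro rfl; simp at hd
  have hprim := isPrimitiveRoot_root_of_dvd_cyclotomic hP hd hPd
  have h0 : P.eval 0 ≠ 0 := by
    obtain ⟨Q, hQ⟩ := hPd.trans (cyclotomic.dvd_X_pow_sub_one d F)
    intro h
    simpa [h, hd0] using congrArg (eval 0) hQ
  rw [isSelfReciprocal_iff_aeval_inv_root hP hmon h0, aeval_eq_zero_iff_exists_pow hP hmon]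
  refine exists_congr fun k ↦ ?_
  rw [← hprim.pow_eq_one_iff_dvd, pow_succ, eq_comm, ← mul_eq_one_iff_eq_inv₀ (hprim.ne_zero hd0)]

open Classical in
/-- `φ(d) / ord_d(q)` when `-1` is a power of `q` modulo `d`, and `0` otherwise: the number of
self-reciprocal monic irreducible factors over `𝔽_q` of the `d`-th cyclotomic polynomial. -/
noncomputable def selfReciprocalWeight (q d : ℕ) : ℚ :=
  if ∃ k, d ∣ q ^ k + 1 then (d.totient : ℚ) / (ordMod d q : ℚ) else 0

lemma ordMod_eq_orderOf_unit {d q : ℕ} (h : q.Coprime d) :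
    ordMod d q = orderOf (ZMod.unitOfCoprime q h) := by
  rw [ordMod, ← orderOf_units, ZMod.coe_unitOfCoprime]

lemma ordMod_pos {d q : ℕ} (h : q.Coprime d) : 0 < ordMod d q := by
  rw [ordMod_eq_orderOf_unit h]
  exact orderOf_pos _

lemma ordMod_dvd_totient {d q : ℕ} (hd : d ≠ 0) (h : q.Coprime d) :
    ordMod d q ∣ d.totient := by
  have := NeZero.mk hd
  rw [ordMod_eq_orderOf_unit h, ← ZMod.card_units_eq_totient]
  exact orderOf_dvd_card

/-- Grouping the factors of `X ^ n - 1` by the order of their roots. -/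
theorem cardOmega_eq_sum_divisors {F : Type*} [Field F] [Fintype F] {n : ℕ}
    (hn : (Fintype.card F).Coprime n) :
    (cardOmega F n : ℚ) = ∑ d ∈ n.divisors, selfReciprocalWeight (Fintype.card F) d := by
  classical
  obtain ⟨p, hp⟩ := CharP.exists F
  obtain ⟨f, hpp, hcard⟩ := FiniteField.card F p
  have := Fact.mk hpp
  have hn0 : n ≠ 0 := by
    rintro rfl
    rw [Nat.coprime_zero_right] at hn
    exact (Fintype.one_lt_card (α := F)).ne' hn
  have hcop : ∀ d ∈ n.divisors, p.Coprime d := fun d hd ↦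
    ((hn.coprime_dvd_right (Nat.dvd_of_mem_divisors hd)).coprime_dvd_left
      (hcard ▸ dvd_pow_self p f.2.ne'))
  have hne : ∀ d ∈ n.divisors, (d : F) ≠ 0 := fun d hd h ↦
    (hpp.coprime_iff_not_dvd.1 (hcop d hd)) ((CharP.cast_eq_zero_iff F p d).1 h)
  let S : ℕ → Finset F[X] := fun d ↦
    if ∃ k, d ∣ Fintype.card F ^ k + 1 then
      (UniqueFactorizationMonoid.normalizedFactors (cyclotomic d F)).toFinset else ∅
  have hmem : ∀ d P, P ∈ S d ↔ (∃ k, d ∣ Fintype.card F ^ k + 1) ∧ Irreducible P ∧ P.Monic ∧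
      P ∣ cyclotomic d F := by
    intro d P
    by_cases h : ∃ k, d ∣ Fintype.card F ^ k + 1
    · simp only [S, if_pos h, Multiset.mem_toFinset,
        Polynomial.mem_normalizedFactors_iff (cyclotomic_ne_zero d F)]
      exact (and_iff_right h).symm
    · simp [S, h]
  have hset : selfReciprocalFactors F n = (n.divisors.biUnion S : Finset F[X]) := by
    ext P
    simp only [selfReciprocalFactors, Set.mem_ofPred_eq, Finset.mem_coe, Finset.mem_biUnion, hmem]
    constructor
    · rintro ⟨hm, hi, hdvd, hs⟩
      rw [← prod_cyclotomic_eq_X_pow_sub_one (Nat.pos_of_ne_zero hn0) F,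
        hi.prime.dvd_finsetProd_iff] at hdvd
      obtain ⟨d, hd, hPd⟩ := hdvd
      exact ⟨d, hd, (isSelfReciprocal_iff_of_dvd_cyclotomic hi hm (hne d hd) hPd).1 hs,
        hi, hm, hPd⟩
    · rintro ⟨d, hd, hk, hi, hm, hPd⟩
      refine ⟨hm, hi, ?_, (isSelfReciprocal_iff_of_dvd_cyclotomic hi hm (hne d hd) hPd).2 hk⟩
      rw [← prod_cyclotomic_eq_X_pow_sub_one (Nat.pos_of_ne_zero hn0) F]
      exact hPd.trans (Finset.dvd_prod_of_mem _ hd)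
  rw [cardOmega, hset, Set.ncard_coe_finset, Finset.card_biUnion, Nat.cast_sum]
  · refine Finset.sum_congr rfl fun d hd ↦ ?_
    have hd0 := (Nat.pos_of_mem_divisors hd).ne'
    have hqd : (Fintype.card F).Coprime d := hn.coprime_dvd_right (Nat.dvd_of_mem_divisors hd)
    by_cases h : ∃ k, d ∣ Fintype.card F ^ k + 1
    · simp only [S, selfReciprocalWeight, if_pos h]
      rw [normalizedFactors_cyclotomic_card hcard (hcop d hd),
        ← Nat.cast_div (ordMod_dvd_totient hd0 hqd)
          (Nat.cast_ne_zero.2 (ordMod_pos hqd).ne'),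
        ordMod_eq_orderOf_unit hqd]
      congr 3
      simp only [hcard]
    · simp [S, selfReciprocalWeight, h]
  · intro d hd e he hde
    rw [Function.onFun, Finset.disjoint_left]
    intro P hPd hPe
    rw [hmem] at hPd hPe
    have := Fact.mk hPd.2.1
    exact hde ((isPrimitiveRoot_root_of_dvd_cyclotomic hPd.2.1 (hne d hd) hPd.2.2.2).unique
      (isPrimitiveRoot_root_of_dvd_cyclotomic hPe.2.1 (hne e he) hPe.2.2.2))

/-! ### Multiplicative orders and the residue `-1` -/

lemma ordMod_dvd_iff {n q k : ℕ} : ordMod n q ∣ k ↔ q ^ k ≡ 1 [MOD n] := by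
  rw [ordMod, orderOf_dvd_iff_pow_eq_one, ← Nat.cast_pow, ← Nat.cast_one,
    ZMod.natCast_eq_natCast_iff]

lemma ordMod_dvd_ordMod {n n' : ℕ} (h : n ∣ n') (q : ℕ) : ordMod n q ∣ ordMod n' q :=
  ordMod_dvd_iff.2 ((ordMod_dvd_iff.1 dvd_rfl).of_dvd h)

lemma ordMod_mul_of_coprime {a b : ℕ} (h : a.Coprime b) (q : ℕ) :
    ordMod (a * b) q = (ordMod a q).lcm (ordMod b q) := by
  apply Nat.dvd_antisymm
  · rw [ordMod_dvd_iff, ← Nat.modEq_and_modEq_iff_modEq_mul h, ← ordMod_dvd_iff, ← ordMod_dvd_iff]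
    exact ⟨Nat.dvd_lcm_left _ _, Nat.dvd_lcm_right _ _⟩
  · exact Nat.lcm_dvd (ordMod_dvd_ordMod (Nat.dvd_mul_right a b) q)
      (ordMod_dvd_ordMod (Nat.dvd_mul_left b a) q)

@[simp] lemma ordMod_one_left (q : ℕ) : ordMod 1 q = 1 :=
  Nat.dvd_one.1 (ordMod_dvd_iff.2 (Nat.modEq_one))

lemma ordMod_sq_of_even {n q : ℕ} (h : Even (ordMod n q)) :
    ordMod n (q ^ 2) = ordMod n q / 2 := by
  rw [ordMod, Nat.cast_pow, orderOf_pow' _ two_ne_zero, ← ordMod,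
    Nat.gcd_eq_right h.two_dvd]

/-- If `q ^ o ≡ 1` modulo `ℓ`, then `q ^ (o * ℓ ^ j) ≡ 1` modulo `ℓ ^ (j + 1)`, so the orders of `q`
modulo `ℓ ^ (j + 1)` and modulo `ℓ` differ by a divisor of `ℓ ^ j`. -/
lemma exists_odd_ordMod_prime_pow {ℓ : ℕ} (hodd : Odd ℓ) (q j : ℕ) :
    ∃ c, Odd c ∧ ordMod (ℓ ^ (j + 1)) q = ordMod ℓ q * c := by
  rcases Nat.eq_zero_or_pos (ordMod ℓ q) with h0 | hpos
  · refine ⟨1, odd_one, ?_⟩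
    have := ordMod_dvd_ordMod (dvd_pow_self ℓ j.succ_ne_zero) q
    rw [h0, zero_dvd_iff] at this
    rw [h0, zero_mul]
    exact this
  have hdvd : ordMod (ℓ ^ (j + 1)) q ∣ ordMod ℓ q * ℓ ^ j := by
    rw [ordMod_dvd_iff, pow_mul, ← Int.natCast_modEq_iff, Int.modEq_comm, Int.modEq_iff_dvd]
    have h1 : q ^ ordMod ℓ q ≡ 1 [MOD ℓ] := ordMod_dvd_iff.1 dvd_rfl
    rw [← Int.natCast_modEq_iff, Int.modEq_comm, Int.modEq_iff_dvd] at h1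
    simpa using dvd_sub_pow_of_dvd_sub h1 j
  obtain ⟨c, hc⟩ := ordMod_dvd_ordMod (dvd_pow_self ℓ j.succ_ne_zero) q
  refine ⟨c, ?_, hc⟩
  rw [hc] at hdvd
  exact Odd.of_dvd_nat hodd.pow (Nat.dvd_of_mul_dvd_mul_left hpos hdvd)

/-- Modulo a power of an odd prime, `-1` is the only square root of `1` other than `1`. -/
lemma prime_pow_dvd_pow_add_one_iff {ℓ : ℕ} (hℓ : ℓ.Prime) (hodd : Odd ℓ) {q j k : ℕ} :
    ℓ ^ (j + 1) ∣ q ^ k + 1 ↔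
      ordMod (ℓ ^ (j + 1)) q ∣ 2 * k ∧ ¬ ordMod (ℓ ^ (j + 1)) q ∣ k := by
  have hℓ2 : ¬ (ℓ : ℤ) ∣ 2 := by
    intro h
    have h2 : ℓ ∣ 2 := by exact_mod_cast h
    rcases (Nat.dvd_prime Nat.prime_two).1 h2 with h | h
    · exact hℓ.one_lt.ne' h
    · rw [h] at hodd; exact absurd hodd (by decide)
  have hp : Prime (ℓ : ℤ) := Nat.prime_iff_prime_int.1 hℓ
  have hself : (ℓ : ℤ) ∣ (ℓ : ℤ) ^ (j + 1) := dvd_pow_self _ j.succ_ne_zero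
  have key : ∀ k, ordMod (ℓ ^ (j + 1)) q ∣ k ↔ (ℓ : ℤ) ^ (j + 1) ∣ (q : ℤ) ^ k - 1 := by
    intro k
    rw [ordMod_dvd_iff, ← Int.natCast_modEq_iff, Int.modEq_comm, Int.modEq_iff_dvd]
    simp
  have hz : ℓ ^ (j + 1) ∣ q ^ k + 1 ↔ (ℓ : ℤ) ^ (j + 1) ∣ (q : ℤ) ^ k + 1 := by
    exact_mod_cast Int.natCast_dvd_natCast.symm
  rw [key, key, hz]
  have hfac : (q : ℤ) ^ (2 * k) - 1 = (q ^ k - 1) * (q ^ k + 1) := by ring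
  rw [hfac]
  constructor
  · refine fun h ↦ ⟨h.mul_left _, fun h' ↦ hℓ2 ?_⟩
    have := hself.trans (dvd_sub h h')
    ring_nf at this
    exact this
  · rintro ⟨h, hn⟩
    by_cases h1 : (ℓ : ℤ) ∣ q ^ k - 1
    · refine absurd (hp.pow_dvd_of_dvd_mul_right _ (fun h2 ↦ hℓ2 ?_) h) hn
      have := dvd_sub h2 h1
      ring_nf at this
      exact this
    · exact hp.pow_dvd_of_dvd_mul_left _ h1 h

lemma exists_prime_pow_dvd_pow_add_one_iff {ℓ : ℕ} (hℓ : ℓ.Prime) (hodd : Odd ℓ) {q : ℕ}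
    (hq : q.Coprime ℓ) (j : ℕ) :
    (∃ k, ℓ ^ (j + 1) ∣ q ^ k + 1) ↔ Even (ordMod ℓ q) := by
  obtain ⟨c, hc, ho⟩ := exists_odd_ordMod_prime_pow hodd q j
  have hpos : 0 < ordMod (ℓ ^ (j + 1)) q := ordMod_pos (hq.pow_right _)
  have heven : Even (ordMod (ℓ ^ (j + 1)) q) ↔ Even (ordMod ℓ q) := by
    rw [ho, Nat.even_mul, or_iff_left (Nat.not_even_iff_odd.2 hc)]
  simp_rw [prime_pow_dvd_pow_add_one_iff hℓ hodd]
  rw [← heven]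
  constructor
  · rintro ⟨k, h1, h2⟩
    by_contra h
    exact h2 ((Nat.coprime_two_right.2 (Nat.not_even_iff_odd.1 h)).dvd_of_dvd_mul_left h1)
  · rintro ⟨b, hb⟩
    refine ⟨b, by rw [hb, two_mul], fun h ↦ ?_⟩
    have := Nat.le_of_dvd (by omega) h
    omega

lemma exists_odd_prime_pow_dvd_pow_add_one_iff {ℓ : ℕ} (hℓ : ℓ.Prime) (hodd : Odd ℓ) {q : ℕ}
    (hq : q.Coprime ℓ) (j : ℕ) :
    (∃ k, Odd k ∧ ℓ ^ (j + 1) ∣ q ^ k + 1) ↔ ordMod ℓ q % 4 = 2 := by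
  obtain ⟨c, hc, ho⟩ := exists_odd_ordMod_prime_pow hodd q j
  have hpos : 0 < ordMod (ℓ ^ (j + 1)) q := ordMod_pos (hq.pow_right _)
  constructor
  · rintro ⟨k, hk, h⟩
    obtain ⟨b, hb⟩ := (exists_prime_pow_dvd_pow_add_one_iff hℓ hodd hq j).1 ⟨k, h⟩
    rw [prime_pow_dvd_pow_add_one_iff hℓ hodd, ho, hb, ← two_mul, mul_assoc] at h
    have hbk : b ∣ k := (Dvd.intro _ rfl).trans (Nat.dvd_of_mul_dvd_mul_left two_pos h.1)
    obtain ⟨t, ht⟩ := Odd.of_dvd_nat hk hbk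
    omega
  · intro h
    have hb : ordMod ℓ q = 2 * (ordMod ℓ q / 2) := by omega
    have hbodd : Odd (ordMod ℓ q / 2) := ⟨ordMod ℓ q / 4, by omega⟩
    refine ⟨ordMod ℓ q / 2 * c, hbodd.mul hc, ?_⟩
    rw [prime_pow_dvd_pow_add_one_iff hℓ hodd, ← mul_assoc, ← hb, ← ho]
    refine ⟨dvd_rfl, fun h' ↦ ?_⟩
    have hle := Nat.le_of_dvd (hbodd.mul hc).pos h'
    rw [ho] at hle
    have := Nat.le_of_mul_le_mul_right hle hc.pos
    omega

lemma not_four_dvd_pow_add_one {q : ℕ} (hq : q % 4 = 1) (k : ℕ) : ¬ 4 ∣ q ^ k + 1 := by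
  have : q ^ k ≡ 1 [MOD 4] := by simpa using Nat.ModEq.pow k (show q ≡ 1 [MOD 4] from hq)
  have h : q ^ k % 4 = 1 := this
  omega

/-- For `k` odd, `q ^ k + 1` and `q + 1` are divisible by the same powers of `2` up to
`2 ^ (a + 1)`, because `q ^ 2 ≡ 1` modulo `2 ^ (a + 1)`; for `k` even `q ^ k + 1 ≡ 2` modulo `4`. -/
lemma two_pow_dvd_pow_add_one_iff {q a : ℕ} (hq : q % 4 = 3) (ha : 2 ^ a ∣ q + 1)
    (ha' : ¬ 2 ^ (a + 1) ∣ q + 1) (i k : ℕ) :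
    2 ^ (i + 2) ∣ q ^ k + 1 ↔ Odd k ∧ i + 2 ≤ a := by
  have hsq : q ^ 2 ≡ 1 [MOD 2 ^ (a + 1)] := by
    refine ((Nat.modEq_iff_dvd' (Nat.one_le_pow _ _ (by omega))).2 ?_).symm
    have h : q ^ 2 - 1 = (q + 1) * (q - 1) := by simpa using Nat.sq_sub_sq q 1
    rw [h, pow_succ]
    exact Nat.mul_dvd_mul ha (by omega)
  rcases Nat.even_or_odd k with hk | hk
  · refine iff_of_false (fun h ↦ ?_) (fun h ↦ Nat.not_odd_iff_even.2 hk h.1)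
    obtain ⟨t, rfl⟩ := hk
    have h4 : 4 ∣ q ^ (t + t) + 1 := (Dvd.intro_left (2 ^ i) (by rw [pow_add]; norm_num)).trans h
    rw [← two_mul, pow_mul] at h4
    exact not_four_dvd_pow_add_one (by rw [Nat.pow_mod, hq]; norm_num) t h4
  · rw [and_iff_right hk]
    have hmod : q ^ k + 1 ≡ q + 1 [MOD 2 ^ (a + 1)] := by
      obtain ⟨t, rfl⟩ := hk
      rw [pow_succ q, pow_mul]
      simpa using ((hsq.pow t).mul_right q).add_right 1
    constructor
    · intro h
      by_contra hlt
      exact ha' ((hmod.dvd_iff dvd_rfl).1 ((pow_dvd_pow 2 (by omega)).trans h))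
    · intro h
      exact (hmod.dvd_iff (pow_dvd_pow 2 (by omega))).2 ((pow_dvd_pow 2 h).trans ha)

lemma ordMod_two_of_odd {q : ℕ} (hq : Odd q) : ordMod 2 q = 1 :=
  Nat.dvd_one.1 (ordMod_dvd_iff.2 (by rw [pow_one]; exact Nat.odd_iff.1 hq))

lemma ordMod_two_pow {q i : ℕ} (h : 2 ^ (i + 2) ∣ q + 1) : ordMod (2 ^ (i + 2)) q = 2 := by
  have h4 : 4 ∣ q + 1 := (Dvd.intro_left (2 ^ i) (by rw [pow_add]; norm_num)).trans h
  refine ((Nat.dvd_prime Nat.prime_two).1 (ordMod_dvd_iff.2 ?_)).resolve_left fun h1 ↦ ?_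
  · refine ((Nat.modEq_iff_dvd' (Nat.one_le_pow _ _ (by omega))).2 ?_).symm
    have h' : q ^ 2 - 1 = (q + 1) * (q - 1) := by simpa using Nat.sq_sub_sq q 1
    rw [h']
    exact h.mul_right _
  · have h2 : q ^ 1 ≡ 1 [MOD 2 ^ (i + 2)] := ordMod_dvd_iff.1 h1.dvd
    have h3 : q ^ 1 ≡ 1 [MOD 4] := h2.of_dvd (Dvd.intro_left (2 ^ i) (by rw [pow_add]; norm_num))
    rw [pow_one] at h3
    have h5 : q % 4 = 1 := h3
    omega

/-! ### Weights of the divisors of `2 ^ m * ℓ ^ s` -/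

lemma selfReciprocalWeight_one (q : ℕ) : selfReciprocalWeight q 1 = 1 := by
  simp [selfReciprocalWeight]

lemma selfReciprocalWeight_eq_zero {q d : ℕ} (h : ∀ k, ¬ d ∣ q ^ k + 1) :
    selfReciprocalWeight q d = 0 :=
  if_neg (not_exists.2 h)

/-- Every odd number `q` is `1` modulo `2`, so an additional factor `2` changes nothing. -/
lemma selfReciprocalWeight_two_mul {q d : ℕ} (hq : Odd q) (hd : Odd d) :
    selfReciprocalWeight q (2 * d) = selfReciprocalWeight q d := by
  have hco : Nat.Coprime 2 d := Nat.coprime_two_left.2 hd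
  have hiff : (∃ k, 2 * d ∣ q ^ k + 1) ↔ ∃ k, d ∣ q ^ k + 1 :=
    exists_congr fun k ↦ ⟨fun h ↦ (Nat.dvd_mul_left d 2).trans h,
      fun h ↦ hco.mul_dvd_of_dvd_of_dvd (hq.pow.add_odd odd_one).two_dvd h⟩
  by_cases h : ∃ k, d ∣ q ^ k + 1
  · rw [selfReciprocalWeight, selfReciprocalWeight, if_pos h, if_pos (hiff.2 h),
      Nat.totient_mul hco, Nat.totient_two, one_mul, ordMod_mul_of_coprime hco,
      ordMod_two_of_odd hq, Nat.lcm_one_left]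
  · rw [selfReciprocalWeight, selfReciprocalWeight, if_neg h, if_neg (mt hiff.1 h)]

lemma selfReciprocalWeight_two_pow {q a i : ℕ} (ha : 2 ^ a ∣ q + 1) (hi : i + 2 ≤ a) :
    selfReciprocalWeight q (2 ^ (i + 2)) = 2 ^ i := by
  have hdvd : 2 ^ (i + 2) ∣ q + 1 := (pow_dvd_pow 2 hi).trans ha
  rw [selfReciprocalWeight, if_pos ⟨1, by simpa using hdvd⟩, ordMod_two_pow hdvd,
    Nat.totient_prime_pow_succ Nat.prime_two]
  push_cast
  ring

lemma selfReciprocalWeight_prime_pow {ℓ : ℕ} (hℓ : ℓ.Prime) (hodd : Odd ℓ) {q : ℕ}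
    (hq : q.Coprime ℓ) (j : ℕ) :
    selfReciprocalWeight q (ℓ ^ (j + 1)) = if Even (ordMod ℓ q) then
      ((ℓ ^ (j + 1)).totient : ℚ) / (ordMod (ℓ ^ (j + 1)) q : ℚ) else 0 := by
  simp only [selfReciprocalWeight, exists_prime_pow_dvd_pow_add_one_iff hℓ hodd hq]

/-- For `2 ≤ i + 2 ≤ a`, the exponents `k` with `2 ^ (i + 2) ∣ q ^ k + 1` are the odd ones. -/
lemma selfReciprocalWeight_two_pow_mul_prime_pow {ℓ : ℕ} (hℓ : ℓ.Prime) (hodd : Odd ℓ) {q : ℕ}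
    (hq : q.Coprime ℓ) (hq3 : q % 4 = 3) {a i : ℕ} (ha : 2 ^ a ∣ q + 1)
    (ha' : ¬ 2 ^ (a + 1) ∣ q + 1) (hi : i + 2 ≤ a) (j : ℕ) :
    selfReciprocalWeight q (2 ^ (i + 2) * ℓ ^ (j + 1)) = if ordMod ℓ q % 4 = 2 then
      2 ^ (i + 1) * (((ℓ ^ (j + 1)).totient : ℚ) / (ordMod (ℓ ^ (j + 1)) q : ℚ)) else 0 := by
  have hco : Nat.Coprime (2 ^ (i + 2)) (ℓ ^ (j + 1)) :=
    Nat.Coprime.pow _ _ (Nat.coprime_two_left.2 hodd)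
  have hiff : (∃ k, 2 ^ (i + 2) * ℓ ^ (j + 1) ∣ q ^ k + 1) ↔ ordMod ℓ q % 4 = 2 := by
    rw [← exists_odd_prime_pow_dvd_pow_add_one_iff hℓ hodd hq j]
    refine exists_congr fun k ↦ ?_
    have h2 : 2 ^ (i + 2) ∣ q ^ k + 1 ↔ Odd k :=
      (two_pow_dvd_pow_add_one_iff hq3 ha ha' i k).trans (and_iff_left hi)
    rw [← h2]
    exact ⟨fun h ↦ ⟨(Nat.dvd_mul_right _ _).trans h, (Nat.dvd_mul_left _ _).trans h⟩,
      fun h ↦ hco.mul_dvd_of_dvd_of_dvd h.1 h.2⟩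
  by_cases h : ordMod ℓ q % 4 = 2
  · rw [selfReciprocalWeight, if_pos (hiff.2 h), if_pos h, Nat.totient_mul hco,
      Nat.totient_prime_pow_succ Nat.prime_two, ordMod_mul_of_coprime hco,
      ordMod_two_pow ((pow_dvd_pow 2 hi).trans ha)]
    obtain ⟨c, -, hc⟩ := exists_odd_ordMod_prime_pow hodd q j
    have h2 : 2 ∣ ordMod (ℓ ^ (j + 1)) q := by
      rw [hc]
      exact Dvd.dvd.mul_right (by omega) c
    rw [Nat.lcm_eq_right h2]
    push_cast
    ring
  · rw [selfReciprocalWeight, if_neg (mt hiff.1 h), if_neg h]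

/-- The sum of the weights of the divisors `2 ^ i * ℓ ^ j` with `0 ≤ j ≤ s`. -/
noncomputable def weightRow (q ℓ s i : ℕ) : ℚ :=
  ∑ j ∈ Finset.range (s + 1), selfReciprocalWeight q (2 ^ i * ℓ ^ j)

theorem sum_divisors_eq_sum_weightRow {ℓ : ℕ} (hℓ : ℓ.Prime) (hodd : Odd ℓ) (q m s : ℕ) :
    ∑ d ∈ (2 ^ m * ℓ ^ s).divisors, selfReciprocalWeight q d =
      ∑ i ∈ Finset.range (m + 1), weightRow q ℓ s i := by
  have hco : Nat.Coprime (2 ^ m) (ℓ ^ s) := Nat.Coprime.pow _ _ (Nat.coprime_two_left.2 hodd)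
  rw [Nat.divisors_mul, Finset.mul_def, Finset.sum_image hco.mul_injOn_divisors,
    Finset.sum_product, Nat.sum_divisors_prime_pow Nat.prime_two]
  simp only [Nat.sum_divisors_prime_pow hℓ, weightRow]

lemma weightRow_one {ℓ q : ℕ} (hodd : Odd ℓ) (hq : Odd q) (s : ℕ) :
    weightRow q ℓ s 1 = weightRow q ℓ s 0 :=
  Finset.sum_congr rfl fun j _ ↦ by
    rw [pow_one, pow_zero, one_mul, selfReciprocalWeight_two_mul hq hodd.pow]

/-- The part `d ≥ 1` of `cosetSum`. -/
lemma cosetSum_eq_one_add (q ℓ s : ℕ) : cosetSum q ℓ s = 1 + ∑ j ∈ Finset.range s,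
    ((ℓ ^ (j + 1)).totient : ℚ) / (ordMod (ℓ ^ (j + 1)) q : ℚ) := by
  rw [cosetSum, Finset.sum_range_succ', add_comm]
  simp

lemma weightRow_zero {ℓ : ℕ} (hℓ : ℓ.Prime) (hodd : Odd ℓ) {q : ℕ} (hq : q.Coprime ℓ) (s : ℕ) :
    weightRow q ℓ s 0 = if Even (ordMod ℓ q) then cosetSum q ℓ s else 1 := by
  simp only [weightRow, pow_zero, one_mul, Finset.sum_range_succ', selfReciprocalWeight_one,
    selfReciprocalWeight_prime_pow hℓ hodd hq, cosetSum_eq_one_add]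
  split_ifs <;> simp [add_comm]

lemma weightRow_eq_zero {ℓ q i : ℕ} (h : ∀ k, ¬ 2 ^ i ∣ q ^ k + 1) (s : ℕ) :
    weightRow q ℓ s i = 0 :=
  Finset.sum_eq_zero fun _ _ ↦ selfReciprocalWeight_eq_zero fun k hk ↦
    h k ((Nat.dvd_mul_right _ _).trans hk)

lemma weightRow_add_two {ℓ : ℕ} (hℓ : ℓ.Prime) (hodd : Odd ℓ) {q : ℕ}
    (hq : q.Coprime ℓ) (hq3 : q % 4 = 3) {a i : ℕ} (ha : 2 ^ a ∣ q + 1)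
    (ha' : ¬ 2 ^ (a + 1) ∣ q + 1) (hi : i + 2 ≤ a) (s : ℕ) :
    weightRow q ℓ s (i + 2) =
      2 ^ i * if ordMod ℓ q % 4 = 2 then 2 * cosetSum q ℓ s - 1 else 1 := by
  simp only [weightRow, Finset.sum_range_succ', pow_zero, mul_one,
    selfReciprocalWeight_two_pow ha hi, cosetSum_eq_one_add,
    selfReciprocalWeight_two_pow_mul_prime_pow hℓ hodd hq hq3 ha ha' hi]
  split_ifs
  · rw [← Finset.mul_sum]
    ring
  · simp

/-- A sum over `0, …, m` whose terms double from the third one on, until they vanish beyond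
`a`. -/
lemma sum_range_of_doubling {f : ℕ → ℚ} {A B : ℚ} {a : ℕ} (ha : 1 ≤ a) (h0 : f 0 = A)
    (h1 : f 1 = A) (h2 : ∀ i, i + 2 ≤ a → f (i + 2) = 2 ^ i * B)
    (h3 : ∀ i, a < i + 2 → f (i + 2) = 0) {m : ℕ} (hm : 1 ≤ m) :
    ∑ i ∈ Finset.range (m + 1), f i = 2 * A + (2 ^ (min m a - 1) - 1) * B := by
  induction m, hm using Nat.le_induction with
  | base => rw [Nat.min_eq_left ha]; simp [Finset.sum_range_succ, h0, h1]; ring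
  | succ m hm ih =>
    obtain ⟨n, rfl⟩ := Nat.exists_eq_add_of_le' hm
    rw [Finset.sum_range_succ, ih]
    rcases Nat.lt_or_ge (n + 1) a with h | h
    · rw [h2 n h, Nat.min_eq_left h.le, Nat.min_eq_left h, Nat.add_sub_cancel,
        Nat.succ_eq_add_one, Nat.add_sub_cancel, pow_succ]
      ring
    · rw [h3 n (by omega), Nat.min_eq_right h, Nat.min_eq_right (by omega), add_zero]

/-! ### The number of self-reciprocal factors -/

section Count

variable {F : Type*} [Field F] [Fintype F] {ℓ m a : ℕ}

theorem cardOmega_prime_pow (hℓ : ℓ.Prime) (hodd : Odd ℓ)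
    (hq : (Fintype.card F).Coprime ℓ) (s : ℕ) :
    (cardOmega F (ℓ ^ s) : ℚ) =
      if Even (ordMod ℓ (Fintype.card F)) then cosetSum (Fintype.card F) ℓ s else 1 := by
  rw [cardOmega_eq_sum_divisors (hq.pow_right s), ← weightRow_zero hℓ hodd hq]
  simpa using sum_divisors_eq_sum_weightRow hℓ hodd (Fintype.card F) 0 s

/-- If `m = 1` or `q ≡ 1` modulo `4`, then only the divisors not divisible by `4` contribute. -/
theorem cardOmega_two_pow_mul (hℓ : ℓ.Prime) (hodd : Odd ℓ)
    (hq : (Fintype.card F).Coprime ℓ) (hqodd : Odd (Fintype.card F)) (hm : 1 ≤ m)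
    (h : m = 1 ∨ Fintype.card F % 4 = 1) (s : ℕ) :
    (cardOmega F (2 ^ m * ℓ ^ s) : ℚ) = 2 * cardOmega F (ℓ ^ s) := by
  rw [cardOmega_eq_sum_divisors
      ((Nat.coprime_two_right.2 hqodd).pow_right m |>.mul_right (hq.pow_right s)),
    sum_divisors_eq_sum_weightRow hℓ hodd, cardOmega_prime_pow hℓ hodd hq,
    ← weightRow_zero hℓ hodd hq]
  have h01 : ∑ i ∈ Finset.range 2, weightRow (Fintype.card F) ℓ s i =
      2 * weightRow (Fintype.card F) ℓ s 0 := by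
    rw [Finset.sum_range_succ, Finset.sum_range_one, weightRow_one hodd hqodd, two_mul]
  rcases h with rfl | h
  · exact h01
  · rw [← h01]
    refine (Finset.sum_subset (Finset.range_mono (by omega)) fun i _ hi ↦ ?_).symm
    refine weightRow_eq_zero (fun k hk ↦ not_four_dvd_pow_add_one h k ?_) s
    exact (pow_dvd_pow 2 (show 2 ≤ i by rw [Finset.mem_range] at hi; omega)).trans hk

theorem cardOmega_two_pow_mul_of_mod_four (hℓ : ℓ.Prime) (hodd : Odd ℓ)
    (hq : (Fintype.card F).Coprime ℓ) (hq3 : Fintype.card F % 4 = 3) (hm : 1 ≤ m)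
    (ha : 2 ^ a ∣ Fintype.card F + 1) (ha' : ¬ 2 ^ (a + 1) ∣ Fintype.card F + 1) (s : ℕ) :
    (cardOmega F (2 ^ m * ℓ ^ s) : ℚ) = 2 * cardOmega F (ℓ ^ s) + (2 ^ (min m a - 1) - 1) *
      if ordMod ℓ (Fintype.card F) % 4 = 2 then 2 * cosetSum (Fintype.card F) ℓ s - 1 else 1 := by
  have hqodd : Odd (Fintype.card F) := Nat.odd_iff.2 (by omega)
  rw [cardOmega_eq_sum_divisors
      ((Nat.coprime_two_right.2 hqodd).pow_right m |>.mul_right (hq.pow_right s)),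
    sum_divisors_eq_sum_weightRow hℓ hodd, cardOmega_prime_pow hℓ hodd hq,
    ← weightRow_zero hℓ hodd hq]
  have ha1 : 1 ≤ a := by
    by_contra h
    obtain rfl : a = 0 := by omega
    exact ha' (by rw [zero_add, pow_one]; omega)
  exact sum_range_of_doubling ha1 rfl (weightRow_one hodd hqodd s)
    (fun i hi ↦ weightRow_add_two hℓ hodd hq hq3 ha ha' hi s)
    (fun i hi ↦ weightRow_eq_zero (fun k hk ↦ by
      have := ((two_pow_dvd_pow_add_one_iff hq3 ha ha' i k).1 hk).2
      omega) s) hm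

end Count

/-- Passing from `q` to `q ^ 2` halves all the even orders `ord_{ℓ ^ d}(q)`. -/
lemma cosetSum_sq {ℓ : ℕ} (hodd : Odd ℓ) {q : ℕ}
    (h : Even (ordMod ℓ q)) (s : ℕ) : cosetSum (q ^ 2) ℓ s = 2 * cosetSum q ℓ s - 1 := by
  have key : ∀ j, ((ℓ ^ (j + 1)).totient : ℚ) / (ordMod (ℓ ^ (j + 1)) (q ^ 2) : ℚ) =
      2 * (((ℓ ^ (j + 1)).totient : ℚ) / (ordMod (ℓ ^ (j + 1)) q : ℚ)) := by
    intro j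
    obtain ⟨c, -, hc⟩ := exists_odd_ordMod_prime_pow hodd q j
    have he : Even (ordMod (ℓ ^ (j + 1)) q) := by rw [hc]; exact h.mul_right c
    rw [ordMod_sq_of_even he, Nat.cast_div he.two_dvd (by norm_num), div_div_eq_mul_div]
    push_cast
    ring
  simp only [cosetSum_eq_one_add, key, ← Finset.mul_sum]
  ring

theorem corollary5p9 {F : Type*} [Field F] [Fintype F] {K : Type*} [Field K] [Algebra F K]
    (hK : Module.finrank F K = 2)
    (q : ℕ) (hq : Fintype.card F = q)
    (ℓ m s a : ℕ) (hℓ : ℓ.Prime) (hℓ_odd : Odd ℓ) (hs : 0 < s)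
    (hℓq : Nat.Coprime ℓ q) (hmq : Nat.Coprime (2 ^ m) q)
    (ha : 2 ^ a ∣ q + 1 ∧ ¬ 2 ^ (a + 1) ∣ q + 1) :
    (Odd (ordMod ℓ q) →
      cardOmega F (2 ^ m * ℓ ^ s) = cardOmega F (2 ^ m) ∧
      (m = 0 → cardOmega F (2 ^ m) = 1) ∧
      (m = 1 ∨ (2 ≤ m ∧ 4 ∣ q - 1) → cardOmega F (2 ^ m) = 2) ∧
      (2 ≤ m ∧ ¬ 4 ∣ q - 1 → cardOmega F (2 ^ m) = 2 ^ (min m a - 1) + 1)) ∧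
    (¬ Odd (ordMod ℓ q) →
      (m = 1 ∨ (2 ≤ m ∧ 4 ∣ q - 1) →
        cardOmega F (2 ^ m * ℓ ^ s) = 2 * cardOmega F (ℓ ^ s) ∧
        (2 * cardOmega F (ℓ ^ s) : ℚ) = 2 * cosetSum q ℓ s) ∧
      (2 ≤ m ∧ ¬ 4 ∣ q - 1 →
        (cardOmega F (2 ^ m * ℓ ^ s) : ℚ) =
          2 * cosetSum q ℓ s +
            (2 ^ (min m a - 1) - 1) * (2 * cosetSum q ℓ s - (cardOmega K (ℓ ^ s) : ℚ))) ∧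
      (2 ∣ ordMod ℓ q ∧ ¬ 2 ^ 2 ∣ ordMod ℓ q → cardOmega K (ℓ ^ s) = 1) ∧
      (¬ (2 ∣ ordMod ℓ q ∧ ¬ 2 ^ 2 ∣ ordMod ℓ q) →
        (cardOmega K (ℓ ^ s) : ℚ) = 2 * cosetSum q ℓ s - 1)) := by
  subst hq
  have hqℓ : (Fintype.card F).Coprime ℓ := hℓq.symm
  have hpow := cardOmega_prime_pow (F := F) hℓ hℓ_odd hqℓ s
  have hpow0 := cardOmega_prime_pow (F := F) hℓ hℓ_odd hqℓ 0
  have hsum0 : cosetSum (Fintype.card F) ℓ 0 = 1 := by simp [cosetSum_eq_one_add]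
  rw [hsum0, ite_self, pow_zero] at hpow0
  have hqodd : 1 ≤ m → Odd (Fintype.card F) := fun hm ↦
    Nat.coprime_two_left.1 ((Nat.coprime_pow_left_iff hm 2 _).1 hmq)
  -- `4 ∣ q - 1` for the truncated subtraction, since `q ≥ 1`
  have hmod : 4 ∣ Fintype.card F - 1 ↔ Fintype.card F % 4 = 1 := by
    have := Fintype.card_pos (α := F)
    omega
  -- the two cases with `m ≥ 1`, for any power of `ℓ`; the power `ℓ ^ 0` gives `cardOmega F (2 ^ m)`
  have hdouble : m = 1 ∨ (2 ≤ m ∧ 4 ∣ Fintype.card F - 1) → ∀ t,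
      (cardOmega F (2 ^ m * ℓ ^ t) : ℚ) = 2 * cardOmega F (ℓ ^ t) := fun h t ↦ by
    have hm : 1 ≤ m := by omega
    exact cardOmega_two_pow_mul hℓ hℓ_odd hqℓ (hqodd hm) hm (h.imp_right fun h ↦ hmod.1 h.2) t
  have hfour : 2 ≤ m ∧ ¬ 4 ∣ Fintype.card F - 1 → ∀ t,
      (cardOmega F (2 ^ m * ℓ ^ t) : ℚ) = 2 * cardOmega F (ℓ ^ t) + (2 ^ (min m a - 1) - 1) *
        if ordMod ℓ (Fintype.card F) % 4 = 2 then 2 * cosetSum (Fintype.card F) ℓ t - 1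
        else 1 := fun h t ↦ by
    have hm : 1 ≤ m := by omega
    have hq3 : Fintype.card F % 4 = 3 := by
      have := Nat.odd_iff.1 (hqodd hm)
      have := mt hmod.2 h.2
      omega
    exact cardOmega_two_pow_mul_of_mod_four hℓ hℓ_odd hqℓ hq3 hm ha.1 ha.2 t
  refine ⟨fun ho ↦ ?_, fun ho ↦ ?_⟩
  · rw [if_neg (Nat.not_even_iff_odd.2 ho)] at hpow
    have hne : ordMod ℓ (Fintype.card F) % 4 ≠ 2 := by
      have := Nat.odd_iff.1 ho
      omega
    simp only [if_neg hne] at hfour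
    refine ⟨?_, ?_, fun h ↦ ?_, fun h ↦ ?_⟩
    · rw [← Nat.cast_inj (R := ℚ)]
      rcases Nat.eq_zero_or_pos m with rfl | hm
      · rw [pow_zero, one_mul, hpow, hpow0]
      · by_cases h : m = 1 ∨ (2 ≤ m ∧ 4 ∣ Fintype.card F - 1)
        · have h0 := hdouble h 0
          rw [pow_zero, mul_one] at h0
          rw [h0, hdouble h s, hpow, hpow0]
        · have h' : 2 ≤ m ∧ ¬ 4 ∣ Fintype.card F - 1 := by omega
          have h0 := hfour h' 0
          rw [pow_zero, mul_one] at h0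
          rw [h0, hfour h' s, hpow, hpow0]
    · rintro rfl
      rw [pow_zero]
      exact_mod_cast hpow0
    · have h0 := hdouble h 0
      rw [pow_zero, mul_one, hpow0, mul_one] at h0
      exact_mod_cast h0
    · have h0 := hfour h 0
      rw [pow_zero, mul_one, hpow0] at h0
      rw [← Nat.cast_inj (R := ℚ), h0]
      push_cast
      ring
  · rw [Nat.not_odd_iff_even] at ho
    rw [if_pos ho] at hpow
    -- the field `K` has `q ^ 2` elements, and `ord_ℓ(q ^ 2)` is even iff `4 ∣ ord_ℓ(q)`
    have hKcard : (cardOmega K (ℓ ^ s) : ℚ) = if ordMod ℓ (Fintype.card F) % 4 = 2 then 1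
        else 2 * cosetSum (Fintype.card F) ℓ s - 1 := by
      have : Module.Finite F K := Module.finite_of_finrank_pos (by omega)
      have : Finite K := Module.finite_of_finite F
      have := Fintype.ofFinite K
      have hcard : Fintype.card K = Fintype.card F ^ 2 := by
        rw [Module.card_eq_pow_finrank (K := F), hK]
      rw [cardOmega_prime_pow hℓ hℓ_odd (by rw [hcard]; exact hqℓ.pow_left 2), hcard,
        ordMod_sq_of_even ho, cosetSum_sq hℓ_odd ho]
      have h2 := Nat.even_iff.1 ho
      by_cases h : ordMod ℓ (Fintype.card F) % 4 = 2
      · rw [if_pos h, if_neg (by rw [Nat.even_iff]; omega)]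
      · rw [if_neg h, if_pos (by rw [Nat.even_iff]; omega)]
    have hmod2 : (2 ∣ ordMod ℓ (Fintype.card F) ∧ ¬ 2 ^ 2 ∣ ordMod ℓ (Fintype.card F)) ↔
        ordMod ℓ (Fintype.card F) % 4 = 2 := by omega
    refine ⟨fun h ↦ ⟨by exact_mod_cast hdouble h s, by rw [hpow]⟩, fun h ↦ ?_, fun h ↦ ?_,
      fun h ↦ ?_⟩
    · rw [hfour h s, hpow, hKcard]
      split_ifs <;> ring
    · rw [if_pos (hmod2.1 h)] at hKcard
      exact_mod_cast hKcard
    · rw [hKcard, if_neg (mt hmod2.2 h)]
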